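/- Assume $\diamondsuit^+$: there is a sequence $(\mathcal A_\alpha)_{\alpha<\omega_1}$ of countable sets such that for every $X\subseteq\omega_1$ there is a club $C\subseteq\omega_1$ with $C\cap\alpha\in\mathcal A_\alpha$ and $X\cap\alpha\in\mathcal A_\alpha$ for every $\alpha\in C$. An $\aleph_1$-tree is a partial order in which the predecessors of each node are well-ordered, each level $\xi<\omega_1$ (the set of nodes whose predecessors have order type $\xi$) is countable and non-empty, and every node has height less than $\omega_1$. A branch is a maximal chain. A Suslin tree is an $\aleph_1$-tree with no uncountable branch and no uncountable antichain (set of pairwise incomparable nodes). Let $2^{<\omega_1}=\bigcup_{\alpha<\omega_1}2^\alpha$ be ordered by end-extension; for a downward closed $T\subseteq 2^{<\omega_1}$ and $\alpha<\omega_1$, let $T\upharpoonright\alpha$ be the set of nodes of $T$ of height less than $\alpha$. Then there is a map $X\mapsto T^X$ assigning to every $X\subseteq\omega_1$ a downward closed subset $T^X\subseteq 2^{<\omega_1}$ which, with the induced order, is an $\aleph_1$-tree, such that for all $X,Y\subseteq\omega_1$: 1. for every $\alpha<\omega_1$, if $X\cap\alpha=Y\cap\alpha$, then $T^X\upharpoonright\alpha=T^Y\upharpoonright\alpha$;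 2. if $X$ is stationary, then $T^X$ is a Suslin tree; 3. if $X$ is non-stationary, then $T^X$ has an uncountable branch. -/

import Mathlib

/-- The first uncountable ordinal `ω₁`, as the linearly ordered type of all countable ordinals. -/
abbrev Omega1 : Type 1 := Set.Iio (Ordinal.omega 1 : Ordinal.{0})

/-- The principle `◇⁺`. For `α < ω₁` the set `α` is identified with its set of predecessors
`Set.Iio α`. -/
def DiamondPlus : Prop :=
  ∃ A : Omega1 → Set (Set Omega1),
    (∀ α, (A α).Countable) ∧
    ∀ X : Set Omega1, ∃ C : Set Omega1, IsClub C ∧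
      ∀ α ∈ C, C ∩ Set.Iio α ∈ A α ∧ X ∩ Set.Iio α ∈ A α

section Trees

variable (P : Type*) [PartialOrder P]

/-- The level `P_ξ`: the nodes of height `ξ`, that is, those whose set of predecessors has
order type `ξ`. -/
def treeLevel (ξ : Omega1) : Set P :=
  {t | Nonempty (Set.Iio t ≃o Set.Iio ξ)}

/-- `ℵ₁`-trees: the predecessors of each node are well-ordered, there are no nodes of height
`≥ ω₁`, and for each `ξ < ω₁` the level `P_ξ` is countable and non-empty. -/
structure IsAleph1Tree : Prop where
  wellOrder : ∀ t : P, IsWellOrder (Set.Iio t) (· < ·)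
  height_lt : ∀ t : P, ∃ ξ : Omega1, t ∈ treeLevel P ξ
  countable_level : ∀ ξ : Omega1, (treeLevel P ξ).Countable
  nonempty_level : ∀ ξ : Omega1, (treeLevel P ξ).Nonempty

/-- A branch is a maximal chain. -/
def HasUncountableBranch : Prop :=
  ∃ b : Set P, IsMaxChain (· ≤ ·) b ∧ ¬ b.Countable

/-- Aronszajn trees: `ℵ₁`-trees without uncountable branches. -/
def IsAronszajnTree : Prop :=
  IsAleph1Tree P ∧ ¬ HasUncountableBranch P

/-- Suslin trees: Aronszajn trees without uncountable antichains (sets of pairwise incomparable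
nodes). -/
def IsSuslinTree : Prop :=
  IsAronszajnTree P ∧ ∀ A : Set P, IsAntichain (· ≤ ·) A → A.Countable

end Trees

/-- The elements of `2^{<ω₁}`: a length `α < ω₁` together with a function `α → 2`. -/
structure BinSeq where
  length : Omega1
  val : Set.Iio length → Bool

/-- `2^{<ω₁}` is ordered by end-extension. -/
instance : PartialOrder BinSeq where
  le s t := ∃ h : s.length ≤ t.length,
    ∀ ξ : Set.Iio s.length, t.val ⟨ξ.1, lt_of_lt_of_le ξ.2 h⟩ = s.val ξ
  le_refl s := ⟨le_rfl, fun _ => rfl⟩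
  le_trans s t u := by
    rintro ⟨h₁, e₁⟩ ⟨h₂, e₂⟩
    exact ⟨h₁.trans h₂, fun ξ => (e₂ ⟨ξ.1, lt_of_lt_of_le ξ.2 h₁⟩).trans (e₁ ξ)⟩
  le_antisymm s t := by
    rintro ⟨h₁, e₁⟩ ⟨h₂, -⟩
    obtain ⟨α, f⟩ := s
    obtain ⟨β, g⟩ := t
    obtain rfl : α = β := le_antisymm h₁ h₂
    congr 1
    funext ξ
    exact (e₁ ξ).symm

/-- `T ↾ α`: the nodes of `T` of height less than `α`. (In a downward closed `T ⊆ 2^{<ω₁}` the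
height of a node is its length.) -/
def treeRestrict (T : Set BinSeq) (α : Omega1) : Set BinSeq :=
  {s ∈ T | s.length < α}

/-! The tree is built by recursion on levels, with all extensions kept at successors. At a limit
`δ`, above each earlier node `t` one cofinal branch is kept that meets every dense set coded in `A
δ`. If `δ ∉ X`, the branches traced by a canonical path along `a ∩ b`, for `a, b ∈ A δ` with `a ∩ b`
cofinal in `δ`, are kept as well. Both families are countable. All choices use `Classical.epsilon`
on data below `δ`, so level `δ` depends only on `X` up to `δ`; this gives coherence.

If `X` is stationary, code a dense set `D` as a subset of `ω₁`. Some `δ ∈ X` guesses it correctly;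
every node of level `δ` is generic there and so lies above a member of `D`. Suitable choices of `D`
bound the heights in any branch or antichain.

If `X` misses a club `C`, let `D` be the club that `◇⁺` gives for `C`, and `E = D ∩ C`. For `α ∈ E`
both `D ∩ α` and `C ∩ α` lie in `A α`, so `E ∩ α` has the form `a ∩ b`, and `α ∉ X` admits its path.
Hence the path along `E` never gets stuck and yields an uncountable branch. -/

open Set Order

/-! ### Countable bounds and clubs in `ω₁`. -/

namespace Omega1

instance : Nonempty Omega1 := ⟨⟨0, Ordinal.omega_pos 1⟩⟩

theorem countable_Iio (δ : Omega1) : (Iio δ).Countable := by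
  have h : (Iio δ.1).Countable := by
    rw [← Cardinal.le_aleph0_iff_set_countable, Cardinal.mk_Iio_ordinal, Cardinal.lift_le_aleph0,
      ← Order.lt_succ_iff, Cardinal.succ_aleph0, ← Cardinal.lt_ord, Cardinal.ord_aleph]
    exact δ.2
  exact (h.preimage Subtype.val_injective).mono fun _ hx => hx

theorem exists_gt_of_countable {s : Set Omega1} (hs : s.Countable) : ∃ b, ∀ a ∈ s, a < b := by
  have hc : Countable s := hs
  have h : ⨆ a : s, succ a.1.1 < Ordinal.omega 1 := Ordinal.iSup_lt_omega_one fun a =>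
    (Cardinal.isSuccLimit_omega 1).succ_lt a.1.2
  refine ⟨⟨_, h⟩, fun a ha => ?_⟩
  have := Ordinal.le_iSup (fun a : s => succ a.1.1) ⟨a, ha⟩
  exact Subtype.mk_lt_mk.2 ((lt_succ a.1).trans_le this)

instance : NoMaxOrder Omega1 where
  exists_gt a := (exists_gt_of_countable (countable_singleton a)).imp fun _ h => h a rfl

theorem cof_ne_aleph0 : cof Omega1 ≠ Cardinal.aleph0 := by
  intro h
  obtain ⟨s, hs, hc⟩ := Order.exists_cof_eq Omega1
  rw [h] at hc
  obtain ⟨b, hb⟩ := exists_gt_of_countable (Cardinal.le_aleph0_iff_set_countable.1 hc.le)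
  obtain ⟨a, ha, hba⟩ := hs b
  exact (hb a ha).not_ge hba

theorem not_countable_of_isCofinal {s : Set Omega1} (hs : IsCofinal s) : ¬ s.Countable := by
  intro hc
  obtain ⟨b, hb⟩ := exists_gt_of_countable hc
  obtain ⟨a, ha, hba⟩ := hs b
  exact (hb a ha).not_ge hba

theorem exists_injective_prod_nat : ∃ e : Omega1 × ℕ → Omega1, Function.Injective e := by
  have h : Cardinal.mk (Omega1 × ℕ) ≤ Cardinal.mk Omega1 := by
    rw [Cardinal.mk_prod, Cardinal.mk_nat, Cardinal.lift_aleph0, Cardinal.lift_uzero,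
      Cardinal.mul_aleph0_eq (Cardinal.infinite_iff.1 NoMaxOrder.infinite)]
  obtain ⟨e⟩ := h
  exact ⟨e, e.injective⟩

/-- The nonzero ordinals closed under a function form a club. -/
theorem isClub_closed (h : Omega1 → Omega1) :
    IsClub {δ : Omega1 | ¬ IsMin δ ∧ ∀ α < δ, h α < δ} := by
  refine ⟨fun d hd hne _ a ha => ⟨?_, fun α hα => ?_⟩, fun a => ?_⟩
  · obtain ⟨x, hx⟩ := hne
    exact fun hmin => (hd hx).1 (hmin.mono (ha.1 hx))
  · obtain ⟨x, hx, hαx⟩ := (lt_isLUB_iff ha).1 hα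
    exact ((hd hx).2 α hαx).trans_le (ha.1 hx)
  · have step : ∀ b : Omega1, ∃ c, b < c ∧ ∀ α < b, h α < c := fun b => by
      obtain ⟨c, hc⟩ := exists_gt_of_countable
        (((countable_Iio b).image h).union (countable_singleton b))
      exact ⟨c, hc b (.inr rfl), fun α hα => hc _ (.inl ⟨α, hα, rfl⟩)⟩
    -- Closing off `ω` times: the supremum of the iterates of `g` is closed under `h`.
    choose g hg hgh using step
    let u : ℕ → Omega1 := fun n => g^[n] a
    have hu : ∀ n, u (n + 1) = g (u n) := fun n => Function.iterate_succ_apply' g n a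
    obtain ⟨b, hb⟩ := exists_gt_of_countable (countable_range u)
    obtain ⟨δ, hδ, hmin⟩ := WellFounded.has_min (wellFounded_lt (α := Omega1))
      (upperBounds (range u)) ⟨b, fun x hx => (hb x hx).le⟩
    have hlt : ∀ n, u n < δ := fun n =>
      (hg (u n)).trans_le (hu n ▸ hδ ⟨n + 1, rfl⟩)
    refine ⟨δ, ⟨fun hm => (hm.not_lt) (hlt 0), fun α hα => ?_⟩, (hlt 0).le⟩
    have : α ∉ upperBounds (range u) := fun hα' => hmin α hα' hα
    simp only [mem_upperBounds, mem_range, forall_exists_index, forall_apply_eq_imp_iff,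
      not_forall, not_le] at this
    obtain ⟨n, hn⟩ := this
    exact (hgh _ _ hn).trans (hu n ▸ hlt (n + 1))

end Omega1

/-! ### Restrictions, unions and successors of binary sequences. -/

namespace BinSeq

instance : Nonempty BinSeq := ⟨⟨Classical.arbitrary _, fun _ => false⟩⟩

open Classical in
/-- The values of a sequence, extended by `false`. -/
noncomputable def eval (s : BinSeq) (ξ : Omega1) : Bool :=
  if h : ξ < s.length then s.val ⟨ξ, h⟩ else false

/-- The restriction to `δ` of a sequence of length `ω₁`. -/
def ofFun (δ : Omega1) (f : Omega1 → Bool) : BinSeq := ⟨δ, fun ξ => f ξ.1⟩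

theorem eval_ofFun {δ ξ : Omega1} (f : Omega1 → Bool) (h : ξ < δ) : (ofFun δ f).eval ξ = f ξ :=
  dif_pos h

theorem le_iff {s t : BinSeq} :
    s ≤ t ↔ s.length ≤ t.length ∧ ∀ ξ < s.length, s.eval ξ = t.eval ξ := by
  constructor
  · rintro ⟨h, e⟩
    refine ⟨h, fun ξ hξ => ?_⟩
    rw [eval, eval, dif_pos hξ, dif_pos (hξ.trans_le h)]
    exact (e ⟨ξ, hξ⟩).symm
  · rintro ⟨h, e⟩
    refine ⟨h, fun ξ => ?_⟩
    have hξ : ξ.1 < s.length := ξ.2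
    have := e ξ hξ
    rw [eval, eval, dif_pos hξ, dif_pos (hξ.trans_le h)] at this
    exact this.symm

theorem length_le {s t : BinSeq} (h : s ≤ t) : s.length ≤ t.length := h.1

theorem eval_eq {s t : BinSeq} (h : s ≤ t) {ξ : Omega1} (hξ : ξ < s.length) :
    s.eval ξ = t.eval ξ := (le_iff.1 h).2 ξ hξ

theorem le_of_le_of_length_le {s t u : BinSeq} (hs : s ≤ u) (ht : t ≤ u)
    (h : s.length ≤ t.length) : s ≤ t :=
  le_iff.2 ⟨h, fun _ hξ => (eval_eq hs hξ).trans (eval_eq ht (hξ.trans_le h)).symm⟩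

theorem eq_of_le_of_length_eq {s t : BinSeq} (h : s ≤ t) (hl : s.length = t.length) : s = t :=
  h.antisymm (le_of_le_of_length_le le_rfl h hl.ge)

theorem lt_iff {s t : BinSeq} : s < t ↔ s ≤ t ∧ s.length < t.length := by
  refine ⟨fun h => ⟨h.le, (length_le h.le).lt_of_ne fun e => h.ne (eq_of_le_of_length_eq h.le e)⟩,
    fun h => h.1.lt_of_ne ?_⟩
  rintro rfl
  exact h.2.false

/-- The initial segment of length `β`. -/
noncomputable def res (s : BinSeq) (β : Omega1) : BinSeq := ofFun β s.eval

theorem res_le {s : BinSeq} {β : Omega1} (h : β ≤ s.length) : s.res β ≤ s :=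
  le_iff.2 ⟨h, fun _ hξ => eval_ofFun _ hξ⟩

theorem res_of_le {s t : BinSeq} {β : Omega1} (h : s ≤ t) (hl : s.length = β) : t.res β = s := by
  subst hl
  exact eq_of_le_of_length_eq (le_of_le_of_length_le (res_le (length_le h)) h le_rfl) rfl

theorem res_self (s : BinSeq) : s.res s.length = s := res_of_le le_rfl rfl

theorem le_res {s t : BinSeq} {β : Omega1} (h : s ≤ t) (hs : s.length ≤ β) (hβ : β ≤ t.length) :
    s ≤ t.res β := le_of_le_of_length_le h (res_le hβ) hs

theorem res_res {s : BinSeq} {β γ : Omega1} (h : γ ≤ β) (hβ : β ≤ s.length) :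
    (s.res β).res γ = s.res γ :=
  res_of_le (le_res (res_le (h.trans hβ)) h hβ) rfl

theorem exists_upperBound {Q : Set BinSeq} {δ : Omega1} (hQ : IsChain (· ≤ ·) Q)
    (hδ : ∀ q ∈ Q, q.length ≤ δ) : ∃ s : BinSeq, s.length = δ ∧ ∀ q ∈ Q, q ≤ s := by
  classical
  refine ⟨ofFun δ fun ξ => if h : ∃ q ∈ Q, ξ < q.length then h.choose.eval ξ else false, rfl,
    fun q hq => le_iff.2 ⟨hδ q hq, fun ξ hξ => ?_⟩⟩
  have h : ∃ q ∈ Q, ξ < q.length := ⟨q, hq, hξ⟩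
  rw [eval_ofFun _ (hξ.trans_le (hδ q hq)), dif_pos h]
  obtain ⟨hr, hξr⟩ := h.choose_spec
  rcases hQ.total hq hr with hle | hle
  · exact eval_eq hle hξ
  · exact (eval_eq hle hξr).symm

theorem eq_of_res_eq {s t : BinSeq} {δ : Omega1} (hs : s.length = δ) (ht : t.length = δ)
    (h : ∀ ξ < δ, ∃ β, ξ < β ∧ β ≤ δ ∧ s.res β = t.res β) : s = t := by
  refine eq_of_le_of_length_eq (le_iff.2 ⟨(hs.trans ht.symm).le, fun ξ hξ => ?_⟩) (hs.trans ht.symm)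
  obtain ⟨β, hξβ, hβ, e⟩ := h ξ (hs ▸ hξ)
  rw [← eval_eq (res_le (hβ.trans hs.ge)) hξβ, e, eval_eq (res_le (hβ.trans ht.ge)) hξβ]

/-- The two immediate successors. -/
theorem exists_append (s : BinSeq) {δ : Omega1} (h : s.length ⋖ δ) (b : Bool) :
    ∃ t : BinSeq, s ≤ t ∧ t.length = δ ∧ t.eval s.length = b := by
  classical
  refine ⟨ofFun δ fun ξ => if ξ < s.length then s.eval ξ else b,
    le_iff.2 ⟨h.le, fun ξ hξ => ?_⟩, rfl, ?_⟩
  · rw [eval_ofFun _ (hξ.trans h.lt), if_pos hξ]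
  · rw [eval_ofFun _ h.lt, if_neg (lt_irrefl _)]

theorem eq_of_res_eq_of_eval_eq {s t : BinSeq} {β δ : Omega1} (h : β ⋖ δ) (hs : s.length = δ)
    (ht : t.length = δ) (hres : s.res β = t.res β) (he : s.eval β = t.eval β) : s = t := by
  refine eq_of_le_of_length_eq (le_iff.2 ⟨(hs.trans ht.symm).le, fun ξ hξ => ?_⟩) (hs.trans ht.symm)
  rcases (h.le_of_lt (hs ▸ hξ)).lt_or_eq with hlt | rfl
  · rw [← eval_eq (res_le (hs ▸ h.le)) hlt, hres, eval_eq (res_le (ht ▸ h.le)) hlt]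
  · exact he

end BinSeq

/-! ### The recursive definition of the levels. -/

namespace TreeConstruction

variable (e : Omega1 × ℕ → Omega1) (A : Omega1 → Set (Set Omega1))

/-- An enumeration of `S` when `S` is countable. -/
noncomputable def enumerate (S : Set BinSeq) : ℕ → BinSeq :=
  Classical.epsilon fun f => S ⊆ range f

theorem exists_enumerate_eq {S : Set BinSeq} (hS : S.Countable) {s : BinSeq} (hs : s ∈ S) :
    ∃ n, enumerate S n = s :=
  Classical.epsilon_spec (countable_iff_exists_subset_range.1 hS) hs

/-- The set of nodes of height less than `δ` coded by `S`. -/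
def decode (L : Omega1 → Set BinSeq) (δ : Omega1) (S : Set Omega1) : Set BinSeq :=
  {v | ∃ α < δ, v ∈ L α ∧ ∃ n, enumerate (L α) n = v ∧ e (α, n) ∈ S}

/-- `s` is a cofinal branch of the tree with levels `L β` for `β < δ`. -/
def Through (L : Omega1 → Set BinSeq) (δ : Omega1) (s : BinSeq) : Prop :=
  s.length = δ ∧ ∀ β < δ, s.res β ∈ L β

/-- `S` codes a dense set of nodes of height less than `δ`. -/
def CodesDense (L : Omega1 → Set BinSeq) (δ : Omega1) (S : Set Omega1) : Prop :=
  ∀ β < δ, ∀ u ∈ L β, ∃ v ∈ decode e L δ S, u ≤ v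

/-- `s` is a cofinal branch above `t` that meets each dense set coded in `A δ`. -/
def IsGeneric (L : Omega1 → Set BinSeq) (δ : Omega1) (t s : BinSeq) : Prop :=
  Through L δ s ∧ t ≤ s ∧ ∀ S ∈ A δ, CodesDense e L δ S → ∃ v ∈ decode e L δ S, v ≤ s

/-- The canonical increasing sequence of nodes of the tree with levels `L`, along `c`. -/
noncomputable def path (c : Set Omega1) (L : Omega1 → Set BinSeq) : Omega1 → BinSeq :=
  (wellFounded_lt (α := Omega1)).fix fun β ih =>
    Classical.epsilon fun s => s ∈ L β ∧ ∀ γ (h : γ < β), γ ∈ c → ih γ h ≤ s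

theorem path_eq (c : Set Omega1) (L : Omega1 → Set BinSeq) (β : Omega1) :
    path c L β = Classical.epsilon fun s => s ∈ L β ∧ ∀ γ < β, γ ∈ c → path c L γ ≤ s :=
  WellFounded.fix_eq _ _ _

theorem path_spec {c : Set Omega1} {L : Omega1 → Set BinSeq} {β : Omega1}
    (h : ∃ s ∈ L β, ∀ γ < β, γ ∈ c → path c L γ ≤ s) :
    path c L β ∈ L β ∧ ∀ γ < β, γ ∈ c → path c L γ ≤ path c L β := by
  have := Classical.epsilon_spec h
  rwa [← path_eq] at this

theorem path_congr {c c' : Set Omega1} {L L' : Omega1 → Set BinSeq} {β : Omega1}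
    (hc : ∀ γ < β, γ ∈ c ↔ γ ∈ c') (hL : ∀ γ ≤ β, L γ = L' γ) : path c L β = path c' L' β := by
  induction β using WellFoundedLT.induction with
  | ind β ih =>
    rw [path_eq, path_eq, hL β le_rfl]
    congr 1
    funext s
    refine propext (and_congr_right fun _ => forall₂_congr fun γ hγ => ?_)
    rw [hc γ hγ, ih γ hγ (fun ξ hξ => hc ξ (hξ.trans hγ)) fun ξ hξ => hL ξ (hξ.trans hγ.le)]

/-- The branches extended at a limit level `δ`: one generic branch above each node, and, if
`p` fails, the canonical branches along `a ∩ b` for `a, b ∈ A δ`. -/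
def limitNodes (p : Prop) (L : Omega1 → Set BinSeq) (δ : Omega1) : Set BinSeq :=
  {s | (∃ β < δ, ∃ t ∈ L β, s = Classical.epsilon (IsGeneric e A L δ t)) ∨
    (¬ p ∧ ∃ a ∈ A δ, ∃ b ∈ A δ, (∀ β < δ, ∃ γ ∈ a ∩ b, β < γ ∧ γ < δ) ∧
      ∀ β ∈ a ∩ b, β < δ → s.res β = path (a ∩ b) L β)}

/-- The level `δ` as a function of the levels below. -/
def nextLevel (p : Prop) (L : Omega1 → Set BinSeq) (δ : Omega1) : Set BinSeq :=
  {s | Through L δ s ∧ (IsSuccLimit δ → s ∈ limitNodes e A p L δ)}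

/-- Every ingredient reads `L` only below `δ`. This is what unfolds the recursion and makes the
trees cohere. -/
theorem nextLevel_congr {p : Prop} {L L' : Omega1 → Set BinSeq} {δ : Omega1}
    (h : ∀ β < δ, L β = L' β) : nextLevel e A p L δ = nextLevel e A p L' δ := by
  have hdec : decode e L δ = decode e L' δ := by
    funext S
    ext v
    exact exists_congr fun α => and_congr_right fun hα => by rw [h α hα]
  have hthr : Through L δ = Through L' δ := by
    funext s
    exact propext (and_congr_right fun _ => forall₂_congr fun β hβ => by rw [h β hβ])
  have hden : CodesDense e L δ = CodesDense e L' δ := by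
    funext S
    exact propext (forall₂_congr fun β hβ => by rw [h β hβ, hdec])
  have hgen : IsGeneric e A L δ = IsGeneric e A L' δ := by
    funext t s
    rw [IsGeneric, IsGeneric, hdec, hthr, hden]
  have hpath : ∀ c, ∀ β < δ, path c L β = path c L' β := fun c β hβ =>
    path_congr (fun _ _ => Iff.rfl) fun γ hγ => h γ (hγ.trans_lt hβ)
  have hlim : limitNodes e A p L δ = limitNodes e A p L' δ := by
    ext s
    refine or_congr (exists_congr fun β => and_congr_right fun hβ => by rw [h β hβ, hgen])
      (and_congr_right fun _ => exists_congr fun a => and_congr_right fun _ =>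
        exists_congr fun b => and_congr_right fun _ => and_congr_right fun _ =>
          forall₃_congr fun β _ hβ => by rw [hpath _ β hβ])
  rw [nextLevel, nextLevel, hthr, hlim]

open Classical in
/-- The levels of the tree associated with `X`. -/
noncomputable def level (X : Set Omega1) : Omega1 → Set BinSeq :=
  (wellFounded_lt (α := Omega1)).fix fun δ ih =>
    nextLevel e A (δ ∈ X) (fun β => if h : β < δ then ih β h else ∅) δ

theorem level_eq (X : Set Omega1) (δ : Omega1) :
    level e A X δ = nextLevel e A (δ ∈ X) (level e A X) δ := by
  rw [level, WellFounded.fix_eq]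
  exact nextLevel_congr e A fun β hβ => dif_pos hβ

theorem level_congr {X Y : Set Omega1} {δ : Omega1} (h : ∀ β ≤ δ, β ∈ X ↔ β ∈ Y) :
    level e A X δ = level e A Y δ := by
  induction δ using WellFoundedLT.induction with
  | ind δ ih =>
    rw [level_eq, level_eq, propext (h δ le_rfl)]
    exact nextLevel_congr e A fun β hβ => ih β hβ fun γ hγ => h γ (hγ.trans hβ.le)

/-! ### Extension of nodes and countability of levels. -/

variable {e A} {X : Set Omega1}

theorem mem_level {δ : Omega1} {s : BinSeq} : s ∈ level e A X δ ↔
    Through (level e A X) δ s ∧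
      (IsSuccLimit δ → s ∈ limitNodes e A (δ ∈ X) (level e A X) δ) := by
  rw [level_eq]
  rfl

theorem length_of_mem_level {δ : Omega1} {s : BinSeq} (h : s ∈ level e A X δ) : s.length = δ :=
  (mem_level.1 h).1.1

theorem res_mem_level {β δ : Omega1} {s : BinSeq} (h : s ∈ level e A X δ) (hβ : β ≤ δ) :
    s.res β ∈ level e A X β := by
  rcases hβ.lt_or_eq with hlt | rfl
  · exact (mem_level.1 h).1.2 β hlt
  · have := length_of_mem_level h
    subst this
    rwa [s.res_self]

theorem mem_level_of_le {δ : Omega1} {s t : BinSeq} (h : s ∈ level e A X δ) (ht : t ≤ s) :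
    t ∈ level e A X t.length := by
  have := res_mem_level h (length_of_mem_level h ▸ BinSeq.length_le ht)
  rwa [BinSeq.res_of_le ht rfl] at this

theorem mem_level_of_covBy {β δ : Omega1} {s : BinSeq} (hδ : β ⋖ δ) (hs : s.length = δ)
    (h : s.res β ∈ level e A X β) : s ∈ level e A X δ := by
  refine mem_level.2 ⟨⟨hs, fun γ hγ => ?_⟩, fun hlim => (hlim.2 β hδ).elim⟩
  have hγβ : γ ≤ β := hδ.le_of_lt hγ
  rw [← BinSeq.res_res hγβ (hs ▸ hδ.le)]
  exact res_mem_level h hγβ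

theorem isMin_or_covBy_or_isSuccLimit (δ : Omega1) :
    IsMin δ ∨ (∃ β, β ⋖ δ) ∨ IsSuccLimit δ := by
  by_cases h₁ : IsMin δ
  · exact .inl h₁
  · by_cases h₂ : ∃ β, β ⋖ δ
    · exact .inr (.inl h₂)
    · exact .inr (.inr ⟨h₁, fun β hβ => h₂ ⟨β, hβ⟩⟩)

/-- At a limit level a chain of nodes of unbounded height has a cofinal branch above it. -/
theorem exists_through {δ : Omega1} {Q : Set BinSeq} (hQ : IsChain (· ≤ ·) Q)
    (hmem : ∀ q ∈ Q, q ∈ level e A X q.length) (hlt : ∀ q ∈ Q, q.length < δ)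
    (hub : ∀ β < δ, ∃ q ∈ Q, β ≤ q.length) :
    ∃ s, Through (level e A X) δ s ∧ ∀ q ∈ Q, q ≤ s := by
  obtain ⟨s, hs, hle⟩ := BinSeq.exists_upperBound hQ fun q hq => (hlt q hq).le
  refine ⟨s, ⟨hs, fun β hβ => ?_⟩, hle⟩
  obtain ⟨q, hq, hβq⟩ := hub β hβ
  rw [← BinSeq.res_res hβq (BinSeq.length_le (hle q hq)), BinSeq.res_of_le (hle q hq) rfl]
  exact res_mem_level (hmem q hq) hβq

/-- A Rasiowa–Sikorski argument: an `ω`-sequence of nodes handles the countably many sets in `A δ`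
while its heights become cofinal in `δ`. Extendibility below `δ` is a hypothesis because the lemma
is used inside the induction proving it. -/
theorem exists_isGeneric (hA : ∀ α, (A α).Countable) {δ : Omega1}
    (hext : ∀ β < δ, ∀ t ∈ level e A X t.length, t.length ≤ β → ∃ s ∈ level e A X β, t ≤ s)
    {t : BinSeq} (ht : t ∈ level e A X t.length) (htδ : t.length < δ) :
    ∃ s, IsGeneric e A (level e A X) δ t s := by
  set L := level e A X with hL
  obtain ⟨f, hf⟩ := countable_iff_exists_subset_range.1 (hA δ)
  obtain ⟨g, hg⟩ := countable_iff_exists_subset_range.1 δ.countable_Iio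
  let N := {u : BinSeq // u ∈ L u.length ∧ u.length < δ}
  have step : ∀ (n : ℕ) (u : N), ∃ v : N, u.1 ≤ v.1 ∧ (g n < δ → g n ≤ v.1.length) ∧
      (CodesDense e L δ (f n) → ∃ w ∈ decode e L δ (f n), w ≤ v.1) := by
    rintro n ⟨u, hu, huδ⟩
    obtain ⟨v, hv, hvδ, huv, hgv⟩ : ∃ v, v ∈ L v.length ∧ v.length < δ ∧ u ≤ v ∧
        (g n < δ → g n ≤ v.length) := by
      -- `g` may also take values outside `Iio δ`; those are ignored.
      have hm : (if g n < δ then max u.length (g n) else u.length) < δ := by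
        split_ifs with h
        · exact max_lt huδ h
        · exact huδ
      obtain ⟨v, hv, huv⟩ := hext _ hm u hu (by split_ifs <;> simp)
      have hvl := length_of_mem_level hv
      refine ⟨v, hvl.symm ▸ hv, hvl ▸ hm, huv, fun h => ?_⟩
      rw [hvl, if_pos h]
      exact le_max_right _ _
    by_cases hd : CodesDense e L δ (f n)
    · obtain ⟨w, hw, hvw⟩ := hd _ hvδ v hv
      have hw' := hw
      obtain ⟨α, hα, hwα, -⟩ := hw'
      have hwl := length_of_mem_level hwα
      exact ⟨⟨w, hwl.symm ▸ hwα, hwl ▸ hα⟩, huv.trans hvw,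
        fun h => (hgv h).trans (BinSeq.length_le hvw), fun _ => ⟨w, hw, le_rfl⟩⟩
    · exact ⟨⟨v, hv, hvδ⟩, huv, hgv, fun h => (hd h).elim⟩
  choose F hF₁ hF₂ hF₃ using step
  let u : ℕ → N := Nat.rec ⟨t, ht, htδ⟩ F
  have hmono : Monotone fun n => (u n).1 := monotone_nat_of_le_succ fun n => hF₁ n (u n)
  obtain ⟨s, hs, hle⟩ := exists_through (e := e) (A := A) (X := X) (δ := δ)
    (Q := range fun n => (u n).1) hmono.isChain_range
    (forall_mem_range.2 fun n => (u n).2.1) (forall_mem_range.2 fun n => (u n).2.2) (by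
      intro β hβ
      obtain ⟨n, rfl⟩ := hg hβ
      exact ⟨_, ⟨n + 1, rfl⟩, hF₂ n (u n) hβ⟩)
  refine ⟨s, hs, hle _ ⟨0, rfl⟩, fun S hS hd => ?_⟩
  obtain ⟨n, rfl⟩ := hf hS
  obtain ⟨w, hw, hwv⟩ := hF₃ n (u n) hd
  exact ⟨w, hw, hwv.trans (hle _ ⟨n + 1, rfl⟩)⟩

theorem exists_ge_mem_level (hA : ∀ α, (A α).Countable) {t : BinSeq}
    (ht : t ∈ level e A X t.length) {δ : Omega1} (h : t.length ≤ δ) :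
    ∃ s ∈ level e A X δ, t ≤ s := by
  induction δ using WellFoundedLT.induction generalizing t with
  | ind δ ih =>
    rcases h.lt_or_eq with hlt | rfl
    swap
    · exact ⟨t, ht, le_rfl⟩
    rcases isMin_or_covBy_or_isSuccLimit δ with hmin | ⟨β, hβ⟩ | hlim
    · exact (hmin.not_lt hlt).elim
    · obtain ⟨s, hs, hts⟩ := ih β hβ.lt ht (hβ.le_of_lt hlt)
      obtain rfl := length_of_mem_level hs
      obtain ⟨s', hss', hl, -⟩ := s.exists_append hβ false
      exact ⟨s', mem_level_of_covBy hβ hl (by rwa [BinSeq.res_of_le hss' rfl]), hts.trans hss'⟩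
    · have hg := Classical.epsilon_spec (exists_isGeneric hA (fun β hβ t ht h => ih β hβ ht h)
        ht hlt)
      exact ⟨_, mem_level.2 ⟨hg.1, fun _ => .inl ⟨_, hlt, t, ht, rfl⟩⟩, hg.2.1⟩

theorem isGeneric_epsilon (hA : ∀ α, (A α).Countable) {δ : Omega1}
    {β : Omega1} (hβ : β < δ) {t : BinSeq} (ht : t ∈ level e A X β) :
    IsGeneric e A (level e A X) δ t (Classical.epsilon (IsGeneric e A (level e A X) δ t)) := by
  obtain rfl := length_of_mem_level ht
  exact Classical.epsilon_spec
    (exists_isGeneric hA (fun β _ t ht h => exists_ge_mem_level hA ht h) ht hβ)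

theorem nonempty_level (hA : ∀ α, (A α).Countable) (δ : Omega1) : (level e A X δ).Nonempty := by
  obtain ⟨o, -, ho⟩ := WellFounded.has_min (wellFounded_lt (α := Omega1)) univ univ_nonempty
  have h : BinSeq.ofFun o (fun _ => false) ∈ level e A X o :=
    mem_level.2 ⟨⟨rfl, fun β hβ => (ho β trivial hβ).elim⟩,
      fun hl => (hl.1 fun β _ => not_lt.1 (ho β trivial)).elim⟩
  obtain ⟨s, hs, -⟩ := exists_ge_mem_level hA h (not_lt.1 (ho δ trivial))
  exact ⟨s, hs⟩

/-- At a limit, generic branches are indexed by earlier nodes, and the others by pairs from `A δ`: a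
branch is determined by its restrictions to a cofinal set. -/
theorem countable_level (hA : ∀ α, (A α).Countable) (δ : Omega1) :
    (level e A X δ).Countable := by
  induction δ using WellFoundedLT.induction with
  | ind δ ih =>
    rcases isMin_or_covBy_or_isSuccLimit δ with hmin | ⟨β, hβ⟩ | hlim
    · refine Set.Subsingleton.countable fun s hs t ht => ?_
      exact BinSeq.eq_of_res_eq (length_of_mem_level hs) (length_of_mem_level ht)
        fun ξ hξ => (hmin.not_lt hξ).elim
    · refine MapsTo.countable_of_injOn (f := fun s : BinSeq => (s.res β, s.eval β))
        (t := level e A X β ×ˢ univ)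
        (fun s hs => ⟨res_mem_level hs hβ.le, trivial⟩) (fun s hs t ht h => ?_)
        ((ih β hβ.lt).prod countable_univ)
      obtain ⟨h₁, h₂⟩ := Prod.mk.inj h
      exact BinSeq.eq_of_res_eq_of_eval_eq hβ (length_of_mem_level hs) (length_of_mem_level ht)
        h₁ h₂
    · have h₁ : (⋃ β ∈ Iio δ, (fun t => Classical.epsilon (IsGeneric e A (level e A X) δ t)) ''
          level e A X β).Countable :=
        δ.countable_Iio.biUnion fun β hβ => (ih β hβ).image _
      have h₂ : (⋃ a ∈ A δ, ⋃ b ∈ A δ, {s : BinSeq | s.length = δ ∧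
          (∀ β < δ, ∃ γ ∈ a ∩ b, β < γ ∧ γ < δ) ∧
          ∀ β ∈ a ∩ b, β < δ → s.res β = path (a ∩ b) (level e A X) β}).Countable := by
        refine (hA δ).biUnion fun a _ => (hA δ).biUnion fun b _ =>
          Set.Subsingleton.countable ?_
        rintro s ⟨hs, hc, hs'⟩ t ⟨ht, -, ht'⟩
        refine BinSeq.eq_of_res_eq hs ht fun ξ hξ => ?_
        obtain ⟨γ, hγ, hξγ, hγδ⟩ := hc ξ hξ
        exact ⟨γ, hξγ, hγδ.le, (hs' γ hγ hγδ).trans (ht' γ hγ hγδ).symm⟩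
      refine (h₁.union h₂).mono fun s hs => ?_
      rcases (mem_level.1 hs).2 hlim with ⟨β, hβ, t, ht, rfl⟩ | ⟨-, a, ha, b, hb, hc, hs'⟩
      · exact .inl (mem_iUnion₂.2 ⟨β, hβ, t, ht, rfl⟩)
      · exact .inr (mem_iUnion₂.2 ⟨a, ha, mem_iUnion₂.2
          ⟨b, hb, length_of_mem_level hs, hc, hs'⟩⟩)

end TreeConstruction

/-! ### Height equals length, and the tree is an `ℵ₁`-tree. -/

theorem Omega1.eq_of_Iio_orderIso {α β : Omega1} (f : Iio α ≃o Iio β) : α = β := by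
  have key : ∀ {α β : Omega1}, (Iio α ≃o Iio β) → α ≤ β := by
    intro α β f
    by_contra! h
    have hg : StrictMono fun x : Iio α => (⟨(f x).1, (f x).2.trans h⟩ : Iio α) :=
      fun x y hxy => f.strictMono hxy
    exact (hg.le_apply (x := ⟨β, h⟩)).not_gt (f ⟨β, h⟩).2
  exact (key f).antisymm (key f.symm)

namespace TreeConstruction

variable {e : Omega1 × ℕ → Omega1} {A : Omega1 → Set (Set Omega1)} {X : Set Omega1}

variable (e A X) in
/-- The tree associated with `X`. -/
def tree : Set BinSeq := {s | s ∈ level e A X s.length}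

theorem isLowerSet_tree : IsLowerSet (tree e A X) := fun _ _ h hs => mem_level_of_le hs h

theorem mem_tree_of_mem_level {δ : Omega1} {s : BinSeq} (h : s ∈ level e A X δ) :
    s ∈ tree e A X := by
  rwa [tree, mem_ofPred_eq, length_of_mem_level h]

theorem res_mem_tree {s : BinSeq} (hs : s ∈ tree e A X) {β : Omega1} (h : β ≤ s.length) :
    s.res β ∈ tree e A X := isLowerSet_tree (BinSeq.res_le h) hs

/-- The predecessors of a node correspond to the ordinals below its length. -/
noncomputable def predecessorsIso (t : tree e A X) : Iio t ≃o Iio t.1.length where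
  toFun u := ⟨u.1.1.length, (BinSeq.lt_iff.1 u.2).2⟩
  invFun β := ⟨⟨t.1.res β, res_mem_tree t.2 (le_of_lt β.2)⟩,
    BinSeq.lt_iff.2 ⟨BinSeq.res_le (le_of_lt β.2), β.2⟩⟩
  left_inv u := Subtype.ext (Subtype.ext (BinSeq.res_of_le (le_of_lt u.2) rfl))
  right_inv _ := rfl
  map_rel_iff' {u v} := ⟨fun h => BinSeq.le_of_le_of_length_le (le_of_lt u.2) (le_of_lt v.2) h,
    fun h => BinSeq.length_le h⟩

theorem mem_treeLevel {t : tree e A X} {ξ : Omega1} :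
    t ∈ treeLevel (tree e A X) ξ ↔ t.1.length = ξ := by
  constructor
  · rintro ⟨f⟩
    exact Omega1.eq_of_Iio_orderIso ((predecessorsIso t).symm.trans f)
  · rintro rfl
    exact ⟨predecessorsIso t⟩

theorem isAleph1Tree (hA : ∀ α, (A α).Countable) : IsAleph1Tree (tree e A X) where
  wellOrder t := (predecessorsIso t).toOrderEmbedding.ltEmbedding.isWellOrder
  height_lt t := ⟨_, mem_treeLevel.2 rfl⟩
  countable_level ξ := ((countable_level (e := e) (X := X) hA ξ).preimage
    Subtype.val_injective).mono fun t ht => mem_treeLevel.1 ht ▸ t.2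
  nonempty_level ξ := by
    obtain ⟨s, hs⟩ := nonempty_level (e := e) (X := X) hA ξ
    exact ⟨⟨s, mem_tree_of_mem_level hs⟩, mem_treeLevel.2 (length_of_mem_level hs)⟩

theorem countable_treeRestrict (hA : ∀ α, (A α).Countable) (δ : Omega1) :
    (treeRestrict (tree e A X) δ).Countable :=
  (δ.countable_Iio.biUnion fun β _ => countable_level (e := e) (X := X) hA β).mono
    fun s hs => mem_iUnion₂.2 ⟨s.length, hs.2, hs.1⟩

theorem treeRestrict_tree_congr {Y : Set Omega1} {α : Omega1} (h : X ∩ Iio α = Y ∩ Iio α) :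
    treeRestrict (tree e A X) α = treeRestrict (tree e A Y) α := by
  ext s
  refine and_congr_left fun hs => ?_
  have : level e A X s.length = level e A Y s.length := level_congr e A fun β hβ => by
    have := Set.ext_iff.1 h β
    simpa [hβ.trans_lt hs] using this
  rw [tree, tree, mem_ofPred_eq, mem_ofPred_eq, this]

/-! ### Stationary `X`: the Suslin property. -/

/-- For stationary `X`, each dense set of nodes is met below all nodes of some height. -/
theorem exists_height_dense_met (he : Function.Injective e) (hA : ∀ α, (A α).Countable)
    (hD : ∀ Z : Set Omega1, ∃ C : Set Omega1, IsClub C ∧ ∀ α ∈ C, Z ∩ Iio α ∈ A α)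
    (hX : IsStationary X) {D : Set BinSeq} (hDT : D ⊆ tree e A X)
    (hdense : ∀ u ∈ tree e A X, ∃ v ∈ D, u ≤ v) :
    ∃ δ, ∀ s ∈ tree e A X, δ ≤ s.length → ∃ v ∈ D, v ≤ s := by
  set L := level e A X with hL
  obtain ⟨C, hC, hCA⟩ := hD {x | ∃ α n, e (α, n) = x ∧ enumerate (L α) n ∈ D}
  choose! v hvD hv using hdense
  -- Closure under this bound makes `δ` a limit, keeps codes of nodes below `δ` under `δ`, and keeps
  -- `D` dense below `δ`.
  have hbound : ∀ α : Omega1, ∃ b, α < b ∧ (∀ n, e (α, n) < b) ∧ ∀ u ∈ L α, (v u).length < b := by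
    intro α
    obtain ⟨b, hb⟩ := Omega1.exists_gt_of_countable (((countable_singleton α).union
      (countable_range fun n => e (α, n))).union
      ((countable_level (e := e) (X := X) hA α).image fun u => (v u).length))
    exact ⟨b, hb _ (.inl (.inl rfl)), fun n => hb _ (.inl (.inr ⟨n, rfl⟩)),
      fun u hu => hb _ (.inr ⟨u, hu, rfl⟩)⟩
  choose h h₁ h₂ h₃ using hbound
  obtain ⟨δ, hδX, hδC, hδmin, hδh⟩ :=
    hX (hC.inter Omega1.cof_ne_aleph0 (Omega1.isClub_closed h))
  have hlim : IsSuccLimit δ :=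
    ⟨hδmin, fun β hβ => hβ.2 (h₁ β) (hδh β hβ.lt)⟩
  set S := {x | ∃ α n, e (α, n) = x ∧ enumerate (L α) n ∈ D} ∩ Iio δ with hS
  -- Injectivity of `e` makes the guessed set decode to exactly the part of `D` below `δ`.
  have hdec : ∀ w, w ∈ decode e L δ S ↔ w ∈ D ∧ w.length < δ := by
    intro w
    constructor
    · rintro ⟨α, hα, hw, n, hn, ⟨β, m, heq, hm⟩, -⟩
      obtain ⟨rfl, rfl⟩ := Prod.mk.inj (he heq)
      exact ⟨hn ▸ hm, length_of_mem_level hw ▸ hα⟩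
    · rintro ⟨hw, hwδ⟩
      obtain ⟨n, hn⟩ := exists_enumerate_eq (countable_level hA w.length) (hDT hw)
      exact ⟨w.length, hwδ, hDT hw, n, hn, ⟨_, n, rfl, by rwa [hL, hn]⟩,
        (h₂ w.length n).trans (hδh _ hwδ)⟩
  have hcodes : CodesDense e L δ S := fun β hβ u hu => by
    have huT := mem_tree_of_mem_level hu
    exact ⟨v u, (hdec _).2 ⟨hvD u huT, (h₃ β u hu).trans (hδh β hβ)⟩, hv u huT⟩
  refine ⟨δ, fun s hs hδs => ?_⟩
  have hres : s.res δ ∈ L δ := res_mem_tree hs hδs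
  rcases (mem_level.1 hres).2 hlim with ⟨β, hβ, t, ht, heq⟩ | ⟨hn, -⟩
  · obtain ⟨w, hw, hws⟩ := (isGeneric_epsilon hA hβ ht).2.2 S (hCA δ hδC) hcodes
    rw [← heq] at hws
    exact ⟨w, ((hdec w).1 hw).1, hws.trans (BinSeq.res_le hδs)⟩
  · exact (hn hδX).elim

theorem isSuslinTree (he : Function.Injective e) (hA : ∀ α, (A α).Countable)
    (hD : ∀ Z : Set Omega1, ∃ C : Set Omega1, IsClub C ∧ ∀ α ∈ C, Z ∩ Iio α ∈ A α)
    (hX : IsStationary X) : IsSuslinTree (tree e A X) := by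
  have countable_of : ∀ {b : Set (tree e A X)} {δ : Omega1}, (∀ t ∈ b, t.1.length < δ) →
      b.Countable := fun {b δ} hb => by
    have h := (countable_treeRestrict (e := e) (X := X) hA δ).preimage
      (Subtype.val_injective (p := (· ∈ tree e A X)))
    refine h.mono fun t ht => ?_
    exact (⟨t.2, hb t ht⟩ : t.1 ∈ treeRestrict (tree e A X) δ)
  refine ⟨⟨isAleph1Tree hA, ?_⟩, fun M hM => ?_⟩
  · rintro ⟨b, hb, hbc⟩
    obtain ⟨δ, hδ⟩ := exists_height_dense_met he hA hD hX
      -- Dense because the two successors of a node cannot both lie below members of a chain.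
      (D := {v | v ∈ tree e A X ∧ ∀ t ∈ b, ¬ v ≤ t.1}) (fun v hv => hv.1) (by
        intro u hu
        obtain ⟨β, hβ⟩ := exists_covBy_of_wellFoundedLT (not_isMax u.length)
        obtain ⟨s₀, hs₀, hl₀, he₀⟩ := u.exists_append hβ false
        obtain ⟨s₁, hs₁, hl₁, he₁⟩ := u.exists_append hβ true
        have mem : ∀ s : BinSeq, u ≤ s → s.length = β → s ∈ tree e A X := fun s hs hl =>
          mem_tree_of_mem_level (mem_level_of_covBy hβ hl (by rwa [BinSeq.res_of_le hs rfl]))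
        by_contra! hc
        have h₀ : ∃ t ∈ b, s₀ ≤ t.1 := by
          by_contra! h
          exact hc s₀ ⟨mem s₀ hs₀ hl₀, h⟩ hs₀
        have h₁ : ∃ t ∈ b, s₁ ≤ t.1 := by
          by_contra! h
          exact hc s₁ ⟨mem s₁ hs₁ hl₁, h⟩ hs₁
        obtain ⟨t₀, ht₀, hst₀⟩ := h₀
        obtain ⟨t₁, ht₁, hst₁⟩ := h₁
        obtain ⟨t, hst, hst'⟩ : ∃ t : BinSeq, s₀ ≤ t ∧ s₁ ≤ t := by
          rcases hb.1.total ht₀ ht₁ with h | h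
          · exact ⟨t₁, hst₀.trans h, hst₁⟩
          · exact ⟨t₀, hst₀, hst₁.trans h⟩
        have := (BinSeq.eval_eq hst (hl₀ ▸ hβ.lt)).trans (BinSeq.eval_eq hst' (hl₁ ▸ hβ.lt)).symm
        rw [he₀, he₁] at this
        exact Bool.noConfusion this)
    refine hbc (countable_of (δ := δ) fun t ht => ?_)
    by_contra! hle
    obtain ⟨v, hv, hvt⟩ := hδ t t.2 hle
    exact hv.2 t ht hvt
  · obtain ⟨δ, hδ⟩ := exists_height_dense_met he hA hD hX
      (D := {v | v ∈ tree e A X ∧ ((∃ a ∈ M, a.1 ≤ v) ∨ ∀ a ∈ M, ¬ v ≤ a.1)}) (fun v hv => hv.1)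
      (by
        intro u hu
        by_cases h : ∃ a ∈ M, u ≤ a.1
        · obtain ⟨a, ha, hua⟩ := h
          exact ⟨a.1, ⟨a.2, .inl ⟨a, ha, le_rfl⟩⟩, hua⟩
        · push Not at h
          exact ⟨u, ⟨hu, .inr h⟩, le_rfl⟩)
    have hM' : ∀ t ∈ M, δ ≤ t.1.length → ∃ a ∈ M, a.1.length ≤ δ ∧ a.1 ≤ t.1 := by
      intro t ht hle
      -- Restricting `t` to `δ` first bounds the height of `v`, hence of `a`, by `δ`.
      obtain ⟨v, ⟨-, hv⟩, hvt⟩ := hδ (t.1.res δ) (res_mem_tree t.2 hle) le_rfl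
      rcases hv with ⟨a, ha, hav⟩ | hv
      · exact ⟨a, ha, BinSeq.length_le (hav.trans hvt), (hav.trans hvt).trans (BinSeq.res_le hle)⟩
      · exact (hv t ht (hvt.trans (BinSeq.res_le hle))).elim
    -- The member `a` may have height exactly `δ`, so the strict bound must be larger.
    obtain ⟨δ', hδ'⟩ := exists_gt δ
    refine countable_of (δ := δ') fun t ht => ?_
    by_contra! hle
    obtain ⟨a, ha, haδ, hat⟩ := hM' t ht (hδ'.le.trans hle)
    obtain rfl : a = t := hM.eq ha ht hat
    exact (haδ.trans_lt hδ').not_ge hle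

/-! ### Non-stationary `X`: the uncountable branch. -/

/-- If `E` is a club disjoint from `X` whose initial segments are guessed on `E`, then the
canonical path along `E` runs through the tree. -/
theorem path_mem_level (hA : ∀ α, (A α).Countable) {E : Set Omega1} (hclub : IsClub E)
    (hE : Disjoint X E)
    (hguess : ∀ α ∈ E, ∃ a ∈ A α, ∃ b ∈ A α, a ∩ b = E ∩ Iio α) {β : Omega1} (hβ : β ∈ E) :
    path E (level e A X) β ∈ level e A X β ∧
      ∀ γ < β, γ ∈ E → path E (level e A X) γ ≤ path E (level e A X) β := by
  induction β using WellFoundedLT.induction with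
  | ind β ih =>
    refine path_spec ?_
    by_cases hmax : ∃ γ ∈ E, γ < β ∧ ∀ ξ ∈ E, ξ < β → ξ ≤ γ
    · obtain ⟨γ, hγ, hγβ, hmax⟩ := hmax
      obtain ⟨h₁, h₂⟩ := ih γ hγβ hγ
      obtain ⟨s, hs, hle⟩ := exists_ge_mem_level hA (mem_tree_of_mem_level h₁)
        (length_of_mem_level h₁ ▸ hγβ.le)
      refine ⟨s, hs, fun ξ hξβ hξ => ?_⟩
      rcases (hmax ξ hξ hξβ).lt_or_eq with hlt | rfl
      · exact (h₂ ξ hlt hξ).trans hle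
      · exact hle
    push Not at hmax
    by_cases hne : ∃ γ ∈ E, γ < β
    swap
    · obtain ⟨s, hs⟩ := nonempty_level (e := e) (X := X) hA β
      exact ⟨s, hs, fun γ hγ hγE => (hne ⟨γ, hγE, hγ⟩).elim⟩
    -- Otherwise the supremum of `E ∩ β` would be below `β` and, by closure, the largest element of
    -- `E ∩ β`.
    have hcof : ∀ ξ < β, ∃ γ ∈ E, ξ < γ ∧ γ < β := by
      by_contra! h
      obtain ⟨ξ, hξβ, hξ⟩ := h
      have hξ' : ξ ∈ upperBounds (E ∩ Iio β) := fun γ hγ => by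
        by_contra! hlt
        exact (hξ γ hγ.1 hlt).not_gt hγ.2
      obtain ⟨δ, hδ, hmin⟩ := WellFounded.has_min (wellFounded_lt (α := Omega1))
        (upperBounds (E ∩ Iio β)) ⟨ξ, hξ'⟩
      have hδE : δ ∈ E := hclub.isLUB_mem inter_subset_left hne
        ⟨hδ, fun x hx => not_lt.1 (hmin x hx)⟩
      obtain ⟨γ, hγ, hγβ, hδγ⟩ := hmax δ hδE ((not_lt.1 (hmin ξ hξ')).trans_lt hξβ)
      exact (hδ ⟨hγ, hγβ⟩).not_gt hδγ
    obtain ⟨s, hs, hle⟩ := exists_through (e := e) (A := A) (X := X) (δ := β)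
      (Q := path E (level e A X) '' (E ∩ Iio β)) (by
        rintro _ ⟨γ, hγ, rfl⟩ _ ⟨ξ, hξ, rfl⟩ -
        rcases lt_trichotomy γ ξ with h | rfl | h
        · exact .inl ((ih ξ hξ.2 hξ.1).2 γ h hγ.1)
        · exact .inl le_rfl
        · exact .inr ((ih γ hγ.2 hγ.1).2 ξ h hξ.1))
      (by
        rintro _ ⟨γ, hγ, rfl⟩
        exact mem_tree_of_mem_level (ih γ hγ.2 hγ.1).1)
      (by
        rintro _ ⟨γ, hγ, rfl⟩
        exact (length_of_mem_level (ih γ hγ.2 hγ.1).1).trans_lt hγ.2)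
      (by
        intro ξ hξ
        obtain ⟨γ, hγ, hξγ, hγβ⟩ := hcof ξ hξ
        exact ⟨_, ⟨γ, ⟨hγ, hγβ⟩, rfl⟩, (length_of_mem_level (ih γ hγβ hγ).1).symm ▸ hξγ.le⟩)
    refine ⟨s, mem_level.2 ⟨hs, fun _ => .inr ⟨hE.notMem_of_mem_right hβ, ?_⟩⟩,
      fun γ hγβ hγ => hle _ ⟨γ, ⟨hγ, hγβ⟩, rfl⟩⟩
    obtain ⟨a, ha, b, hb, hab⟩ := hguess β hβ
    refine ⟨a, ha, b, hb, ?_, ?_⟩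
    · intro ξ hξ
      obtain ⟨γ, hγ, hξγ, hγβ⟩ := hcof ξ hξ
      exact ⟨γ, hab ▸ ⟨hγ, hγβ⟩, hξγ, hγβ⟩
    · intro γ hγ hγβ
      rw [hab] at hγ ⊢
      -- The path at `γ < β` cannot tell the guessed `E ∩ β` from `E`.
      rw [path_congr (c := E ∩ Iio β) (c' := E) (fun ξ hξ => and_iff_left (hξ.trans hγβ)) fun _ _ => rfl]
      exact BinSeq.res_of_le (hle _ ⟨γ, hγ, rfl⟩) (length_of_mem_level (ih γ hγβ hγ.1).1)

theorem hasUncountableBranch (hA : ∀ α, (A α).Countable) {E : Set Omega1} (hclub : IsClub E)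
    (hE : Disjoint X E) (hguess : ∀ α ∈ E, ∃ a ∈ A α, ∃ b ∈ A α, a ∩ b = E ∩ Iio α) :
    HasUncountableBranch (tree e A X) := by
  set L := level e A X with hL
  have hp := fun β (hβ : β ∈ E) => path_mem_level (e := e) hA hclub hE hguess hβ
  let c : Set (tree e A X) := {t | ∃ β ∈ E, t.1 = path E L β}
  have hc : IsChain (· ≤ ·) c := by
    rintro s ⟨β, hβ, hs⟩ t ⟨γ, hγ, ht⟩ hne
    change s.1 ≤ t.1 ∨ t.1 ≤ s.1
    rw [hs, ht]
    rcases lt_trichotomy β γ with h | rfl | h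
    · exact .inl ((hp γ hγ).2 β h hβ)
    · exact .inl le_rfl
    · exact .inr ((hp β hβ).2 γ h hγ)
  obtain ⟨b, hb, hcb⟩ := hc.exists_maxChain
  -- The lengths of nodes in `b` include all of `E`, which is cofinal.
  refine ⟨b, hb, fun hbc => Omega1.not_countable_of_isCofinal hclub.isCofinal ?_⟩
  refine (hbc.image fun t => t.1.length).mono fun β hβ => ?_
  exact ⟨⟨_, mem_tree_of_mem_level (hp β hβ).1⟩, hcb ⟨β, hβ, rfl⟩, length_of_mem_level (hp β hβ).1⟩

end TreeConstruction

theorem mainTheorem2 (hD : DiamondPlus) :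
    ∃ T : Set Omega1 → Set BinSeq,
      (∀ X : Set Omega1, IsLowerSet (T X) ∧ IsAleph1Tree (T X)) ∧
      (∀ (α : Omega1) (X Y : Set Omega1), X ∩ Set.Iio α = Y ∩ Set.Iio α →
        treeRestrict (T X) α = treeRestrict (T Y) α) ∧
      (∀ X : Set Omega1, IsStationary X → IsSuslinTree (T X)) ∧
      (∀ X : Set Omega1, ¬ IsStationary X → HasUncountableBranch (T X)) := by
  obtain ⟨A, hA, hguess⟩ := hD
  obtain ⟨e, he⟩ := Omega1.exists_injective_prod_nat
  refine ⟨TreeConstruction.tree e A,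
    fun X => ⟨TreeConstruction.isLowerSet_tree, TreeConstruction.isAleph1Tree hA⟩,
    fun α X Y h => TreeConstruction.treeRestrict_tree_congr h,
    fun X hX => TreeConstruction.isSuslinTree he hA (fun Z => ?_) hX, fun X hX => ?_⟩
  · obtain ⟨C, hC, h⟩ := hguess Z
    exact ⟨C, hC, fun α hα => (h α hα).2⟩
  · obtain ⟨C, hC, hXC⟩ := not_isStationary_iff.1 hX
    -- Guessing the club `C` itself uses the full strength of `◇⁺`: `D` and `C` are both guessed at
    -- points of `D`.
    obtain ⟨D, hDclub, h⟩ := hguess C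
    refine TreeConstruction.hasUncountableBranch hA (hDclub.inter Omega1.cof_ne_aleph0 hC)
      (hXC.mono_right inter_subset_right) fun α hα => ⟨_, (h α hα.1).1, _, (h α hα.1).2, ?_⟩
    rw [inter_inter_inter_comm, inter_self]
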